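/- For a graph $H$ and a graph $F$, let $ex(n,H,F)$ denote the maximum number of copies of $H$ (that is, subgraphs isomorphic to $H$, not necessarily induced) in a simple graph on $n$ vertices that contains no subgraph isomorphic to $F$. Let $C_m$ denote the cycle on $m$ vertices. For every fixed integer $k\ge 2$, $$ex(n,C_4,C_{2k})=(1+o(1))\,\frac{(k-1)(k-2)}{4}\,n^2\qquad (n\to\infty).$$ (For $k=2$ the right-hand side is $0$, and the assertion is that $ex(n,C_4,C_4)=0$ for all sufficiently large $n$.) -/

import Mathlib

open Filter Asymptotics

open Classical in
/-- The generalized Turán number: the maximum of the number of (unlabelled, not necessarily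
induced) copies of `H` in `G`, over all graphs `G` on `n` vertices that contain no copy of `F`. -/
noncomputable def generalizedTuranNumber {V W : Type*} (n : ℕ) (H : SimpleGraph V)
    (F : SimpleGraph W) : ℕ :=
  (Finset.univ.filter fun G : SimpleGraph (Fin n) => F.Free G).sup fun G => G.copyCount H

/-- If `F` has an edge, then the maximum is over a nonempty set of graphs and is attained. -/
theorem isGreatest_generalizedTuranNumber {V W : Type*} (n : ℕ) (H : SimpleGraph V)
    (F : SimpleGraph W) (hF : F ≠ ⊥) :
    IsGreatest {m : ℕ | ∃ G : SimpleGraph (Fin n), F.Free G ∧ G.copyCount H = m}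
      (generalizedTuranNumber n H F) := by
  classical
  constructor
  · obtain ⟨G, hG, h⟩ := Finset.exists_mem_eq_sup
      (Finset.univ.filter fun G : SimpleGraph (Fin n) => F.Free G)
      ⟨⊥, by simpa using SimpleGraph.free_bot hF⟩ (fun G => G.copyCount H)
    refine ⟨G, by simpa using hG, ?_⟩
    rw [generalizedTuranNumber, ← h]
  · rintro m ⟨G, hG, rfl⟩
    exact Finset.le_sup (f := fun G : SimpleGraph (Fin n) => G.copyCount H) (by simpa using hG)

/-!
The lower bound comes from the complete bipartite graph with parts of sizes `k - 1` and `n - k + 1`: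
it has no `C_{2k}`, as such a cycle needs `k` vertices in each part, and a `C₄` is a choice of two
vertices in each part (`cycleGraph_free_bipartiteAt`, `le_copyCount_bipartiteAt`).

For the upper bound, call a pair of vertices fat if it has at least `k` common neighbours. A 4-cycle
with a diagonal that is not fat is determined by this diagonal and two of its at most `k - 1` common
neighbours, so there are at most `(n choose 2) * (k - 1 choose 2)` of those, which is the main term
(`card_isFourCycle_thin_le`). The 4-cycles with two fat diagonals are negligible: their number is at
most a constant times the number of edges (`card_isFatFourCycle_le`), and a `C_{2k}`-free graph has
`o(n ^ 2)` edges (`eventually_sum_degree_le`).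

To bound the number of fat 4-cycles, edges which lie in boundedly many of them are removed one after
another. If this process stopped before all edges are gone, there would be a nonempty set `R` of
edges each of which lies in many fat 4-cycles over `R`. Then a `C_{2k}` can be built: starting from
one edge, a path whose ends `a`, `b` form an edge of `R` is prolonged by two
(`exists_longer_isPath`). Many fat 4-cycles `a, b, c, d` contain the edge `ab`, so many
vertices `d` (or, symmetrically, many vertices `c`) occur outside the path. If, for one of them, the
fat pair `b, d` has a common neighbour `u` outside the path, then the path can be continued by
`u`, `d`, and `ad` is an edge of `R`. Otherwise all these `d` have at least `k` neighbours on the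
path, so `k` of them share `k` neighbours by the pigeonhole principle, and the resulting `K_{k,k}`
contains a `C_{2k}` (`cycleGraph_isContained_of_card_inter`).

Sequences `a, b, c, d` are counted instead of copies; each `C₄` corresponds to eight of them
(`card_isFourCycle`).
-/

namespace SimpleGraph

/-! ### Labelled and unlabelled copies -/

theorem labelledCopyCount_eq_natCard {V W : Type*} [Fintype V] [Fintype W]
    (G : SimpleGraph V) (H : SimpleGraph W) : G.labelledCopyCount H = Nat.card (H.Copy G) := by
  classical exact Nat.card_eq_fintype_card.symm

/-- A subgraph isomorphic to `H` is the image of exactly `|Aut H|` labelled copies of `H`. -/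
theorem labelledCopyCount_eq_card_iso_mul_copyCount {V W : Type*} [Fintype V] [Fintype W]
    (G : SimpleGraph V) (H : SimpleGraph W) :
    G.labelledCopyCount H = Nat.card (H ≃g H) * G.copyCount H := by
  classical
  rw [copyCount_eq_card_image_copyToSubgraph, labelledCopyCount_eq_natCard,
    Nat.card_eq_fintype_card, ← Finset.card_univ,
    Finset.card_eq_sum_card_image (Copy.toSubgraph (A := H) (B := G)), mul_comm,
    Finset.sum_const_nat]
  intro S hS
  obtain ⟨f₀, -, rfl⟩ := Finset.mem_image.1 hS
  rw [← Nat.card_eq_finsetCard]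
  have hmem : ∀ σ : H ≃g H, f₀.comp σ.toCopy ∈
      Finset.univ.filter fun f : H.Copy G => f.toSubgraph = f₀.toSubgraph := by
    intro σ
    simp only [Finset.mem_filter, Finset.mem_univ, true_and]
    ext a b
    · simp only [Subgraph.map_verts, Subgraph.verts_top, Set.image_univ, Set.mem_range]
      exact ⟨fun ⟨x, hx⟩ => ⟨σ x, hx⟩, fun ⟨x, hx⟩ => ⟨σ.symm x, by simpa using hx⟩⟩
    · simp only [Subgraph.map_adj, Relation.Map, Subgraph.top_adj]
      constructor
      · rintro ⟨x, y, h, hx, hy⟩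
        exact ⟨σ x, σ y, σ.map_adj_iff.2 h, hx, hy⟩
      · rintro ⟨x, y, h, hx, hy⟩
        exact ⟨σ.symm x, σ.symm y, σ.symm.map_adj_iff.2 h, by simpa using hx, by simpa using hy⟩
  refine (Nat.card_congr (Equiv.ofBijective (fun σ : H ≃g H => ⟨f₀.comp σ.toCopy, hmem σ⟩)
    ⟨?_, ?_⟩)).symm
  · intro σ τ h
    ext x
    have := DFunLike.congr_fun (congrArg Subtype.val h) x
    exact f₀.injective this
  · rintro ⟨f, hf⟩
    simp only [Finset.mem_filter, Finset.mem_univ, true_and] at hf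
    let e : f.toSubgraph.coe ≃g f₀.toSubgraph.coe := hf ▸ Iso.refl
    have he : ∀ x, (e x : V) = x := by
      simp only [e]
      clear_value e
      generalize f₀.toSubgraph = S at hf
      subst hf
      intro x; rfl
    refine ⟨(f.isoToSubgraph.trans e).trans f₀.isoToSubgraph.symm,
      Subtype.ext (Copy.ext fun x => ?_)⟩
    have key : ∀ z : f₀.toSubgraph.verts, f₀ (f₀.isoToSubgraph.symm z) = z := by
      intro z
      obtain ⟨w, rfl⟩ := f₀.isoToSubgraph.surjective z
      rw [RelIso.symm_apply_apply]
      rfl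
    exact (key _).trans (he _)

/-- The vertices `a, b, c, d` form, in this cyclic order, a 4-cycle of `G`. -/
def IsFourCycle {V : Type*} (G : SimpleGraph V) (a b c d : V) : Prop :=
  G.Adj a b ∧ G.Adj c b ∧ G.Adj c d ∧ G.Adj a d ∧ a ≠ c ∧ b ≠ d

theorem card_iso_cycleGraph_four : Nat.card (cycleGraph 4 ≃g cycleGraph 4) = 8 := by
  have e : (cycleGraph 4 ≃g cycleGraph 4) ≃
      {σ : Equiv.Perm (Fin 4) // ∀ a b, (cycleGraph 4).Adj (σ a) (σ b) ↔ (cycleGraph 4).Adj a b} :=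
    { toFun := fun f => ⟨f.toEquiv, fun a b => f.map_rel_iff'⟩
      invFun := fun f => ⟨f.1, fun {a b} => f.2 a b⟩
      left_inv := fun f => rfl
      right_inv := fun f => rfl }
  rw [Nat.card_congr e, Nat.card_eq_fintype_card]
  decide +kernel

open scoped Classical in
/-- Each copy of `C₄` is given by eight sequences `a, b, c, d`. -/
theorem card_isFourCycle {V : Type*} [Fintype V] (G : SimpleGraph V) :
    (Finset.univ.filter fun t : V × V × V × V => G.IsFourCycle t.1 t.2.1 t.2.2.1 t.2.2.2).card =
      8 * G.copyCount (cycleGraph 4) := by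
  rw [← card_iso_cycleGraph_four, ← labelledCopyCount_eq_card_iso_mul_copyCount,
    labelledCopyCount_eq_natCard, ← Nat.card_eq_finsetCard]
  have hmem : ∀ f : (cycleGraph 4).Copy G, (f 0, f 1, f 2, f 3) ∈
      Finset.univ.filter fun t : V × V × V × V => G.IsFourCycle t.1 t.2.1 t.2.2.1 t.2.2.2 := by
    intro f
    simp only [Finset.mem_filter, Finset.mem_univ, true_and]
    exact ⟨f.toHom.map_adj (by decide), f.toHom.map_adj (by decide), f.toHom.map_adj (by decide),
      f.toHom.map_adj (by decide), f.injective.ne (by decide), f.injective.ne (by decide)⟩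
  refine (Nat.card_congr (Equiv.ofBijective (fun f : (cycleGraph 4).Copy G => ⟨_, hmem f⟩)
    ⟨?_, ?_⟩)).symm
  · intro f g h
    simp only [Subtype.mk.injEq, Prod.mk.injEq] at h
    ext i
    fin_cases i
    exacts [h.1, h.2.1, h.2.2.1, h.2.2.2]
  · rintro ⟨⟨a, b, c, d⟩, h⟩
    simp only [Finset.mem_filter, Finset.mem_univ, true_and] at h
    obtain ⟨hab, hcb, hcd, had, hac, hbd⟩ := h
    have hadj : ∀ i j, (cycleGraph 4).Adj i j → G.Adj (![a, b, c, d] i) (![a, b, c, d] j) := by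
      intro i j hij
      fin_cases i <;> fin_cases j <;>
        first
        | exact absurd hij (by decide)
        | simp [hab, hcb, hcd, had, hab.symm, hcb.symm, hcd.symm, had.symm]
    have hinj : Function.Injective ![a, b, c, d] := by
      intro i j hij
      have := hab.ne
      have := hcb.ne
      have := hcd.ne
      have := had.ne
      fin_cases i <;> fin_cases j <;> simp_all
    exact ⟨⟨⟨![a, b, c, d], hadj _ _⟩, hinj⟩, rfl⟩

/-! ### Long even cycles -/

theorem cycleGraph_two_mul_isContained_completeBipartiteGraph (k : ℕ) :
    cycleGraph (2 * k) ⊑ completeBipartiteGraph (Fin k) (Fin k) := by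
  refine ⟨⟨⟨fun i => if i.val % 2 = 0 then Sum.inl ⟨i.val / 2, by omega⟩
    else Sum.inr ⟨i.val / 2, by omega⟩, ?_⟩, ?_⟩⟩
  · intro i j hij
    have := (cycleGraph.bicoloring_of_even (2 * k) (even_two_mul k)).valid hij
    simp only [cycleGraph.bicoloring_of_even, Coloring.mk, RelHom.coeFn_mk, ne_eq,
      decide_eq_decide] at this
    by_cases hi : i.val % 2 = 0 <;> by_cases hj : j.val % 2 = 0 <;> simp_all
  · intro i j hij
    simp only [RelHom.coeFn_mk] at hij
    ext
    split_ifs at hij <;> simp at hij <;> omega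

theorem cycleGraph_isContained_of_isPath {V : Type*} {G : SimpleGraph V} {x y : V}
    {n : ℕ} (hn : 2 < n) (h : G.Adj x y)
    {p : G.Walk x y} (hp : p.IsPath) (hlen : p.length + 1 = n) : cycleGraph n ⊑ G := by
  refine (cycleGraph_isContained_iff hn).2 ⟨y, .cons h.symm p, ?_, by simpa⟩
  exact Walk.isCycle_iff_isPath_tail_and_le_length.2 ⟨by simpa using hp, by simp; omega⟩

variable {V : Type*} [Fintype V] [DecidableEq V] {G : SimpleGraph V} [DecidableRel G.Adj] {k : ℕ}

/-- Kővári–Sós–Turán by the pigeonhole principle: if more than `k * 2 ^ |B|` vertices have at least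
`k` neighbours each in `B`, then `k` of them have the same trace on `B`, and together with this
trace they span a `K_{k,k}`. -/
theorem cycleGraph_isContained_of_card_inter {B T : Finset V} (hT : k * 2 ^ B.card < T.card)
    (hB : ∀ x ∈ T, k ≤ (G.neighborFinset x ∩ B).card) : cycleGraph (2 * k) ⊑ G := by
  obtain ⟨S, hS, hcard⟩ := Finset.exists_lt_card_fiber_of_mul_lt_card_of_maps_to
    (f := fun x => G.neighborFinset x ∩ B) (t := B.powerset) (n := k)
    (fun x _ => Finset.mem_powerset.2 Finset.inter_subset_right)
    (by rwa [Finset.card_powerset, mul_comm])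
  obtain ⟨T', hT'sub, hT'⟩ := Finset.exists_subset_card_eq hcard.le
  have hmem : ∀ x ∈ T', x ∈ T ∧ G.neighborFinset x ∩ B = S := fun x hx => by
    simpa using hT'sub hx
  have hSk : k ≤ S.card := by
    obtain ⟨x, hx⟩ := Finset.card_pos.1 (Nat.zero_lt_of_lt hcard)
    obtain ⟨hxT, rfl⟩ := Finset.mem_filter.1 hx
    exact hB x hxT
  obtain ⟨S', hS'sub, hS'⟩ := Finset.exists_subset_card_eq hSk
  refine (cycleGraph_two_mul_isContained_completeBipartiteGraph k).trans
    (completeBipartiteGraph_isContained_iff.2 ⟨T', S', by simpa, by simpa, ?_⟩)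
  intro x hx y hy
  have := hS'sub hy
  rw [← (hmem x hx).2] at this
  exact (G.mem_neighborFinset _ _).1 (Finset.mem_inter.1 this).1

/-- Many vertices of `X` cannot all have `k` common neighbours with `y` inside the small set `C`,
because these would span a `K_{k,k}`. -/
theorem exists_common_neighbor_notMem (hfree : (cycleGraph (2 * k)).Free G) {C X : Finset V}
    {y : V} (hC : C.card ≤ 2 * k) (hX : k * 2 ^ (2 * k) < X.card)
    (hfat : ∀ x ∈ X, k ≤ (G.neighborFinset x ∩ G.neighborFinset y).card) :
    ∃ x ∈ X, ∃ u ∉ C, G.Adj x u ∧ G.Adj y u := by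
  by_contra! hcon
  refine hfree (cycleGraph_isContained_of_card_inter (B := C) (T := X)
    (lt_of_le_of_lt (by gcongr; norm_num) hX) fun x hx => (hfat x hx).trans ?_)
  refine Finset.card_le_card fun u hu => ?_
  simp only [Finset.mem_inter, mem_neighborFinset] at hu ⊢
  exact ⟨hu.1, by_contra fun huC => hcon x hx u huC hu.1 hu.2⟩

/-! ### Four-cycles with two fat diagonals -/

variable (G k) in
/-- A pair of vertices is fat if it has at least `k` common neighbours. -/
def IsFat (x y : V) : Prop := k ≤ (G.neighborFinset x ∩ G.neighborFinset y).card

variable (G k) in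
/-- A sequence `a, b, c, d` is a fat 4-cycle over a set `R` of ordered edges if both its diagonals
`ac` and `bd` are fat and its edges, directed from `{a, c}` to `{b, d}`, lie in `R`. -/
def IsFatFourCycle (R : Finset (V × V)) (a b c d : V) : Prop :=
  (a, b) ∈ R ∧ (c, b) ∈ R ∧ (c, d) ∈ R ∧ (a, d) ∈ R ∧ a ≠ c ∧ b ≠ d ∧
    IsFat G k a c ∧ IsFat G k b d

instance (R : Finset (V × V)) (a b c d : V) : Decidable (IsFatFourCycle G k R a b c d) := by
  unfold IsFatFourCycle IsFat; infer_instance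

variable (G k) in
/-- The ways to complete the directed edge `(a, b)` to a fat 4-cycle `a, b, c, d` over `R`. -/
def fatCompletions (R : Finset (V × V)) (a b : V) : Finset (V × V) :=
  Finset.univ.filter fun q => IsFatFourCycle G k R a b q.1 q.2

/-- A path closed by an edge of `R` can be prolonged by two: the edge has a completion with a new
vertex `d`, or one with a new vertex `c`, outside the path, and as `bd`, respectively `ac`, is fat,
there is also a common neighbour outside the path. -/
theorem exists_longer_isPath (hfree : (cycleGraph (2 * k)).Free G) {R : Finset (V × V)}
    (hrich : ∀ e ∈ R, (2 * k + k * 2 ^ (2 * k)) ^ 2 < (fatCompletions G k R e.1 e.2).card)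
    {a b : V} (hab : (a, b) ∈ R) {p : G.Walk a b} (hp : p.IsPath) (hlen : p.length < 2 * k) :
    ∃ a' b', (a', b') ∈ R ∧ ∃ q : G.Walk a' b', q.IsPath ∧ q.length = p.length + 2 := by
  -- `K` allows for the at most `2 * k` vertices of the path and leaves enough vertices for the
  -- pigeonhole argument of `exists_common_neighbor_notMem`.
  set K := 2 * k + k * 2 ^ (2 * k) with hK
  set N := fatCompletions G k R a b with hN
  set C := p.support.toFinset with hCdef
  have hC : C.card ≤ 2 * k := (List.toFinset_card_le _).trans (by simpa using hlen)
  have hcard : K ^ 2 < (N.image Prod.fst).card * (N.image Prod.snd).card := by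
    rw [← Finset.card_product]
    exact (hrich _ hab).trans_le (Finset.card_le_card Finset.subset_product)
  have hsdiff : ∀ X : Finset V, K < X.card → k * 2 ^ (2 * k) < (X \ C).card := fun X hX => by
    have := Finset.le_card_sdiff C X
    omega
  have hmem : ∀ q ∈ N, IsFatFourCycle G k R a b q.1 q.2 := fun q hq => by
    simpa [hN, fatCompletions] using hq
  rcases le_or_gt (N.image Prod.fst).card K with hle | hlt
  · have hlt : K < (N.image Prod.snd).card := by
      by_contra! h
      have := Nat.mul_le_mul hle h
      rw [pow_two] at hcard
      omega
    have hX : ∀ d ∈ N.image Prod.snd \ C, (a, d) ∈ R ∧ d ∉ C ∧ IsFat G k b d := fun d hd => by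
      obtain ⟨hd, hdC⟩ := Finset.mem_sdiff.1 hd
      obtain ⟨q, hq, rfl⟩ := Finset.mem_image.1 hd
      obtain ⟨-, -, -, had, -, -, -, hbd⟩ := hmem q hq
      exact ⟨had, hdC, hbd⟩
    obtain ⟨d, hd, u, hu, hdu, hbu⟩ := exists_common_neighbor_notMem hfree hC (hsdiff _ hlt)
      (y := b) fun d hd => by simpa only [IsFat, Finset.inter_comm] using (hX d hd).2.2
    obtain ⟨had, hdC, -⟩ := hX d hd
    rw [hCdef, List.mem_toFinset] at hdC hu
    refine ⟨a, d, had, (p.concat hbu).concat hdu.symm, ?_, by simp⟩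
    refine (hp.concat hu hbu).concat ?_ _
    simp [Walk.support_concat, hdC, hdu.ne]
  · have hX : ∀ c ∈ N.image Prod.fst \ C, (c, b) ∈ R ∧ c ∉ C ∧ IsFat G k a c := fun c hc => by
      obtain ⟨hc, hcC⟩ := Finset.mem_sdiff.1 hc
      obtain ⟨q, hq, rfl⟩ := Finset.mem_image.1 hc
      obtain ⟨-, hcb, -, -, -, -, hac, -⟩ := hmem q hq
      exact ⟨hcb, hcC, hac⟩
    obtain ⟨c, hc, u, hu, hcu, hau⟩ := exists_common_neighbor_notMem hfree hC (hsdiff _ hlt)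
      (y := a) fun c hc => by simpa only [IsFat, Finset.inter_comm] using (hX c hc).2.2
    obtain ⟨hcb, hcC, -⟩ := hX c hc
    rw [hCdef, List.mem_toFinset] at hcC hu
    refine ⟨c, b, hcb, .cons hcu (.cons hau.symm p), ?_, by simp⟩
    simp [Walk.cons_isPath_iff, hp, hu, hcC, hcu.ne]

/-- Growing a path two edges at a time closes up to a `C_{2k}`, so in a `C_{2k}`-free graph every
nonempty set of edges has an edge with few completions. -/
theorem exists_card_fatCompletions_le (hk : 2 ≤ k) (hfree : (cycleGraph (2 * k)).Free G)
    {R : Finset (V × V)} (hR : ∀ e ∈ R, G.Adj e.1 e.2) (hne : R.Nonempty) :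
    ∃ e ∈ R, (fatCompletions G k R e.1 e.2).card ≤ (2 * k + k * 2 ^ (2 * k)) ^ 2 := by
  by_contra! hrich
  have hpath : ∀ l < k, ∃ a b, (a, b) ∈ R ∧ ∃ p : G.Walk a b, p.IsPath ∧ p.length = 2 * l + 1 := by
    intro l
    induction l with
    | zero =>
      obtain ⟨⟨a, b⟩, hab⟩ := hne
      exact fun _ => ⟨a, b, hab, (hR _ hab).toWalk, .of_adj (hR _ hab), rfl⟩
    | succ l ih =>
      intro hl
      obtain ⟨a, b, hab, p, hp, hlen⟩ := ih (by omega)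
      obtain ⟨a', b', hab', q, hq, hq'⟩ :=
        exists_longer_isPath hfree hrich hab hp (by omega)
      exact ⟨a', b', hab', q, hq, by omega⟩
  obtain ⟨a, b, hab, p, hp, hlen⟩ := hpath (k - 1) (by omega)
  exact hfree (cycleGraph_isContained_of_isPath (by omega) (hR _ hab) hp (by omega))

/-- Removing an edge with few completions destroys few fat 4-cycles; this is repeated until no
edges are left. -/
theorem card_isFatFourCycle_le (hk : 2 ≤ k) (hfree : (cycleGraph (2 * k)).Free G)
    (R : Finset (V × V)) (hR : ∀ e ∈ R, G.Adj e.1 e.2) :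
    (Finset.univ.filter fun t : V × V × V × V =>
      IsFatFourCycle G k R t.1 t.2.1 t.2.2.1 t.2.2.2).card ≤
        4 * (2 * k + k * 2 ^ (2 * k)) ^ 2 * R.card := by
  induction hn : R.card generalizing R with
  | zero =>
    rw [Finset.card_eq_zero] at hn
    subst hn
    simp [IsFatFourCycle]
  | succ n ih =>
    obtain ⟨⟨x, y⟩, hxy, hle⟩ := exists_card_fatCompletions_le hk hfree hR
      (Finset.card_pos.1 (by omega))
    have ih := ih (R.erase (x, y)) (fun e he => hR e (Finset.mem_of_mem_erase he))
      (by rw [Finset.card_erase_of_mem hxy, hn]; rfl)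
    set N := fatCompletions G k R x y with hN
    -- `(x, y)` is one of the four directed edges of the 4-cycle.
    have hsub : (Finset.univ.filter fun t : V × V × V × V =>
          IsFatFourCycle G k R t.1 t.2.1 t.2.2.1 t.2.2.2) ⊆
        (Finset.univ.filter fun t : V × V × V × V =>
          IsFatFourCycle G k (R.erase (x, y)) t.1 t.2.1 t.2.2.1 t.2.2.2) ∪
        ((N.image fun q => (x, y, q.1, q.2)) ∪ (N.image fun q => (q.1, y, x, q.2)) ∪
        ((N.image fun q => (q.1, q.2, x, y)) ∪ (N.image fun q => (x, q.2, q.1, y)))) := by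
      rintro ⟨a, b, c, d⟩ ht
      simp only [Finset.mem_filter, Finset.mem_univ, true_and] at ht
      have ht' := ht
      obtain ⟨hab, hcb, hcd, had, hac, hbd, hfac, hfbd⟩ := ht
      have hfca : IsFat G k c a := by rwa [IsFat, Finset.inter_comm]
      have hfdb : IsFat G k d b := by rwa [IsFat, Finset.inter_comm]
      simp only [Finset.mem_union, Finset.mem_filter, Finset.mem_univ, true_and, Finset.mem_image,
        Prod.exists, Prod.mk.injEq]
      by_cases h₁ : (a, b) = (x, y)
      · cases h₁
        exact .inr (.inl (.inl ⟨c, d, by simpa [hN, fatCompletions] using ht', rfl, rfl, rfl, rfl⟩))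
      by_cases h₂ : (c, b) = (x, y)
      · cases h₂
        refine .inr (.inl (.inr ⟨a, d, ?_, rfl, rfl, rfl, rfl⟩))
        simpa [hN, fatCompletions] using ⟨hcb, hab, had, hcd, hac.symm, hbd, hfca, hfbd⟩
      by_cases h₃ : (c, d) = (x, y)
      · cases h₃
        refine .inr (.inr (.inl ⟨a, b, ?_, rfl, rfl, rfl, rfl⟩))
        simpa [hN, fatCompletions] using ⟨hcd, had, hab, hcb, hac.symm, hbd.symm, hfca, hfdb⟩
      by_cases h₄ : (a, d) = (x, y)
      · cases h₄
        refine .inr (.inr (.inr ⟨c, b, ?_, rfl, rfl, rfl, rfl⟩))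
        simpa [hN, fatCompletions] using ⟨had, hcd, hcb, hab, hac, hbd.symm, hfac, hfdb⟩
      exact .inl ⟨Finset.mem_erase.2 ⟨h₁, hab⟩, Finset.mem_erase.2 ⟨h₂, hcb⟩,
        Finset.mem_erase.2 ⟨h₃, hcd⟩, Finset.mem_erase.2 ⟨h₄, had⟩, hac, hbd, hfac, hfbd⟩
    refine (Finset.card_le_card hsub).trans ?_
    refine (Finset.card_union_le _ _).trans ?_
    have h4 : ((N.image fun q => (x, y, q.1, q.2)) ∪ (N.image fun q => (q.1, y, x, q.2)) ∪
        ((N.image fun q => (q.1, q.2, x, y)) ∪ (N.image fun q => (x, q.2, q.1, y)))).card ≤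
        (N.card + N.card) + (N.card + N.card) :=
      (Finset.card_union_le _ _).trans (add_le_add
        ((Finset.card_union_le _ _).trans (add_le_add Finset.card_image_le Finset.card_image_le))
        ((Finset.card_union_le _ _).trans (add_le_add Finset.card_image_le Finset.card_image_le)))
    calc _ ≤ 4 * (2 * k + k * 2 ^ (2 * k)) ^ 2 * n + 4 * N.card := by omega
      _ ≤ 4 * (2 * k + k * 2 ^ (2 * k)) ^ 2 * n + 4 * (2 * k + k * 2 ^ (2 * k)) ^ 2 := by gcongr
      _ = _ := by ring

/-! ### Four-cycles with a thin diagonal -/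

/-- A 4-cycle with a thin diagonal `ac` is given by `a`, `c` and two of the at most `k - 1` common
neighbours of `a` and `c`. -/
theorem card_isFourCycle_thin_le [∀ a b c d, Decidable (G.IsFourCycle a b c d)]
    [∀ x y, Decidable (IsFat G k x y)] :
    (Finset.univ.filter fun t : V × V × V × V =>
      G.IsFourCycle t.1 t.2.1 t.2.2.1 t.2.2.2 ∧ ¬ IsFat G k t.1 t.2.2.1).card ≤
        Fintype.card V ^ 2 * ((k - 1) * (k - 2)) := by
  have hsub : (Finset.univ.filter fun t : V × V × V × V =>
      G.IsFourCycle t.1 t.2.1 t.2.2.1 t.2.2.2 ∧ ¬ IsFat G k t.1 t.2.2.1) ⊆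
      ((Finset.univ.filter fun e : V × V => ¬ IsFat G k e.1 e.2).sigma fun e =>
        (G.neighborFinset e.1 ∩ G.neighborFinset e.2).offDiag).image
          fun s => (s.1.1, s.2.1, s.1.2, s.2.2) := by
    rintro ⟨a, b, c, d⟩ ht
    simp only [Finset.mem_filter, Finset.mem_univ, true_and] at ht
    obtain ⟨⟨hab, hcb, hcd, had, hac, hbd⟩, hthin⟩ := ht
    refine Finset.mem_image.2 ⟨⟨(a, c), (b, d)⟩, ?_, rfl⟩
    simp [hthin, hab, hcb, hcd, had, hbd]
  refine (Finset.card_le_card hsub).trans (Finset.card_image_le.trans ?_)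
  rw [Finset.card_sigma]
  refine (Finset.sum_le_card_nsmul _ _ ((k - 1) * (k - 2)) fun e he => ?_).trans ?_
  · have hthin : (G.neighborFinset e.1 ∩ G.neighborFinset e.2).card ≤ k - 1 := by
      have := (Finset.mem_filter.1 he).2
      unfold IsFat at this
      omega
    rw [Finset.offDiag_card, ← Nat.mul_sub_one]
    exact Nat.mul_le_mul hthin (by omega)
  · rw [smul_eq_mul, pow_two, ← Fintype.card_prod]
    gcongr
    exact Finset.card_le_univ _

variable (G k) in
theorem copyCount_cycleGraph_four_le (hk : 2 ≤ k) (hfree : (cycleGraph (2 * k)).Free G) :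
    8 * G.copyCount (cycleGraph 4) ≤ 2 * (Fintype.card V ^ 2 * ((k - 1) * (k - 2))) +
      4 * (2 * k + k * 2 ^ (2 * k)) ^ 2 * ∑ v, G.degree v := by
  classical
  have hR : ∑ v, G.degree v =
      (Finset.univ.filter fun e : V × V => G.Adj e.1 e.2).card := by
    simp only [Finset.card_filter, Fintype.sum_prod_type, ← card_neighborFinset_eq_degree,
      neighborFinset_eq_filter]
  rw [hR, ← card_isFourCycle]
  have hthin := card_isFourCycle_thin_le (G := G) (k := k)
  have hthin' : (Finset.univ.filter fun t : V × V × V × V =>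
      G.IsFourCycle t.1 t.2.1 t.2.2.1 t.2.2.2 ∧ ¬ IsFat G k t.2.1 t.2.2.2).card ≤
        Fintype.card V ^ 2 * ((k - 1) * (k - 2)) := by
    refine le_trans (Finset.card_le_card_of_injOn (fun t => (t.2.1, t.2.2.1, t.2.2.2, t.1))
      ?_ ?_) hthin
    · rintro ⟨a, b, c, d⟩ ht
      simp only [Finset.coe_filter, Finset.mem_univ, true_and, Set.mem_ofPred_eq] at ht ⊢
      obtain ⟨⟨hab, hcb, hcd, had, hac, hbd⟩, hthin⟩ := ht
      exact ⟨⟨hcb.symm, hcd.symm, had.symm, hab.symm, hbd, hac.symm⟩, hthin⟩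
    · rintro ⟨a, b, c, d⟩ - ⟨a', b', c', d'⟩ - h
      simp only [Prod.mk.injEq] at h ⊢
      tauto
  have hfat := card_isFatFourCycle_le hk hfree
    (Finset.univ.filter fun e : V × V => G.Adj e.1 e.2) (by simp)
  refine (Finset.card_le_card (t := _ ∪ _ ∪ _) ?_).trans ((Finset.card_union_le _ _).trans
    (add_le_add ((Finset.card_union_le _ _).trans ((add_le_add hthin hthin').trans_eq
      (two_mul _).symm)) hfat))
  rintro ⟨a, b, c, d⟩ ht
  simp only [Finset.mem_filter, Finset.mem_univ, true_and, Finset.mem_union] at ht ⊢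
  have ht' := ht
  obtain ⟨hab, hcb, hcd, had, hac, hbd⟩ := ht
  by_cases h₁ : IsFat G k a c
  · by_cases h₂ : IsFat G k b d
    · right
      simp [IsFatFourCycle, *]
    · exact .inl (.inr ⟨ht', h₂⟩)
  · exact .inl (.inl ⟨ht', h₁⟩)

end SimpleGraph

namespace SimpleGraph

/-! ### The number of edges -/

/-- If many vertices have linear degree, then, by double counting, many vertices have many
neighbours among a bounded number of them, so that there is a `K_{k,k}`. -/
theorem eventually_sum_degree_le (k : ℕ) {ε : ℝ} (hε : 0 < ε) :
    ∀ᶠ n : ℕ in atTop, ∀ (G : SimpleGraph (Fin n)) [DecidableRel G.Adj],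
      (cycleGraph (2 * k)).Free G → (∑ v, G.degree v : ℕ) ≤ ε * (n : ℝ) ^ 2 := by
  obtain ⟨M, hM⟩ := exists_nat_ge ((k + 1) / (ε / 2))
  rw [div_le_iff₀ (by positivity)] at hM
  -- The first bound on `n` contradicts `M` vertices of degree at least `ε / 2 * n`; the second one
  -- makes the contribution of fewer such vertices negligible.
  filter_upwards [eventually_gt_atTop (M * (k * 2 ^ M)),
    tendsto_natCast_atTop_atTop.eventually_ge_atTop (M / (ε / 2))] with n hn hn' G _ hfree
  rw [div_le_iff₀ (by positivity)] at hn'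
  set big := Finset.univ.filter fun v => ε / 2 * n ≤ (G.degree v : ℝ) with hbig
  have hcard : big.card ≤ M := by
    by_contra! hlt
    obtain ⟨B, hBsub, hB⟩ := Finset.exists_subset_card_eq hlt.le
    set T := Finset.univ.filter fun w => k ≤ (G.neighborFinset w ∩ B).card with hTdef
    have hT : T.card ≤ k * 2 ^ M := by
      by_contra! hT
      exact hfree (cycleGraph_isContained_of_card_inter (B := B) (T := T) (by rwa [hB])
        fun x hx => (Finset.mem_filter.1 hx).2)
    have hdouble : ∑ b ∈ B, G.degree b = ∑ w, (G.neighborFinset w ∩ B).card := by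
      simp only [← card_neighborFinset_eq_degree, neighborFinset_eq_filter,
        Finset.filter_inter, Finset.univ_inter, Finset.card_filter]
      rw [Finset.sum_comm]
      simp only [G.adj_comm]
    have hupper : ∑ w, (G.neighborFinset w ∩ B).card ≤ n * k + M * (k * 2 ^ M) := by
      have : ∀ w, (G.neighborFinset w ∩ B).card ≤ k + if w ∈ T then M else 0 := fun w => by
        have hle := Finset.card_le_card (Finset.inter_subset_right (s₁ := G.neighborFinset w)
          (s₂ := B))
        split_ifs with hw
        · omega
        · simp only [hTdef, Finset.mem_filter, Finset.mem_univ, true_and] at hw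
          omega
      refine (Finset.sum_le_sum fun w _ => this w).trans ?_
      rw [Finset.sum_add_distrib, Finset.sum_ite_mem, Finset.univ_inter, Finset.sum_const,
        Finset.sum_const, Finset.card_fin, smul_eq_mul, smul_eq_mul, mul_comm T.card]
      gcongr
    have hlower : M * (ε / 2 * n) ≤ ((∑ b ∈ B, G.degree b : ℕ) : ℝ) := by
      rw [Nat.cast_sum, ← hB, ← nsmul_eq_mul]
      exact Finset.card_nsmul_le_sum _ _ _ fun b hb => (Finset.mem_filter.1 (hBsub hb)).2
    rw [hdouble] at hlower
    have h₁ : (∑ w, (G.neighborFinset w ∩ B).card : ℕ) < ((n * k + n : ℕ) : ℝ) := by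
      exact_mod_cast hupper.trans_lt (by omega)
    have h₂ := mul_le_mul_of_nonneg_right hM (Nat.cast_nonneg (α := ℝ) n)
    push_cast at h₁ hlower
    linarith
  have hdeg : ∀ v, (G.degree v : ℝ) ≤ (if v ∈ big then (n : ℝ) else 0) + ε / 2 * n := fun v => by
    have hlt : (G.degree v : ℝ) ≤ n := by
      exact_mod_cast (G.degree_lt_card_verts v).le.trans_eq (Fintype.card_fin n)
    split_ifs with hv
    · have : 0 ≤ ε / 2 * n := by positivity
      linarith
    · simp only [hbig, Finset.mem_filter, Finset.mem_univ, true_and, not_le] at hv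
      linarith
  have hcard' : (big.card : ℝ) ≤ M := by exact_mod_cast hcard
  calc ((∑ v, G.degree v : ℕ) : ℝ) ≤ ∑ v, ((if v ∈ big then (n : ℝ) else 0) + ε / 2 * n) := by
        rw [Nat.cast_sum]
        exact Finset.sum_le_sum fun v _ => hdeg v
    _ = big.card * n + n * (ε / 2 * n) := by
        simp [Finset.sum_add_distrib, Finset.sum_ite_mem]
    _ ≤ (n * (ε / 2)) * n + n * (ε / 2 * n) := by
        gcongr
        exact hcard'.trans hn'
    _ = ε * (n : ℝ) ^ 2 := by ring

/-! ### The extremal construction -/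

/-- The complete bipartite graph between the first `s` vertices and the other vertices. -/
def bipartiteAt (s n : ℕ) : SimpleGraph (Fin n) where
  Adj i j := ¬(i.val < s ↔ j.val < s)
  symm := ⟨fun _ _ h h' => h h'.symm⟩
  loopless := ⟨fun _ h => h Iff.rfl⟩

/-- The `k` disjoint edges of `C_{2k}` would each need a vertex in the small part. -/
theorem cycleGraph_free_bipartiteAt {k : ℕ} (hk : 1 ≤ k) (n : ℕ) :
    (cycleGraph (2 * k)).Free (bipartiteAt (k - 1) n) := by
  rintro ⟨f⟩
  have hedge : ∀ i : Fin k, (f ⟨2 * i, by omega⟩).val < k - 1 ∨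
      (f ⟨2 * i + 1, by omega⟩).val < k - 1 := fun i => by
    have hadj : (cycleGraph (2 * k)).Adj ⟨2 * i, by omega⟩ ⟨2 * i + 1, by omega⟩ :=
      pathGraph_le_cycleGraph (by simp [pathGraph_adj])
    have : ¬ (_ ↔ _) := f.toHom.map_adj hadj
    simp only [Copy.toHom_apply] at this
    tauto
  choose g hg using fun i : Fin k => show ∃ j : Fin (2 * k), j.val / 2 = i.val ∧
    (f j).val < k - 1 from (hedge i).elim (fun h => ⟨_, by simp, h⟩)
      fun h => ⟨_, by simp; omega, h⟩
  have hinj : Function.Injective fun i => (⟨(f (g i)).val, (hg i).2⟩ : Fin (k - 1)) := by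
    intro i j hij
    have : g i = g j := f.injective (Fin.ext (Fin.mk.inj_iff.1 hij))
    ext
    rw [← (hg i).1, ← (hg j).1, this]
  have := Fintype.card_le_of_injective _ hinj
  simp only [Fintype.card_fin] at this
  omega

theorem le_copyCount_bipartiteAt {s n : ℕ} (hs : s ≤ n) :
    2 * ((s * (s - 1)) * ((n - s) * (n - s - 1))) ≤
      8 * (bipartiteAt s n).copyCount (cycleGraph 4) := by
  classical
  rw [← card_isFourCycle]
  set A := Finset.univ.filter fun i : Fin n => i.val < s with hA
  have hAcard : A.card = s := by simp [hA, Fin.card_filter_val_lt, hs]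
  have hAcard' : Aᶜ.card = n - s := by rw [Finset.card_compl, hAcard, Fintype.card_fin]
  have hoff : (A.offDiag ×ˢ Aᶜ.offDiag).card = (s * (s - 1)) * ((n - s) * (n - s - 1)) := by
    rw [Finset.card_product, Finset.offDiag_card, Finset.offDiag_card, hAcard, hAcard',
      Nat.mul_sub_one, Nat.mul_sub_one]
  set P := A.offDiag ×ˢ Aᶜ.offDiag with hP
  have h₁ : (P.image fun q => (q.1.1, q.2.1, q.1.2, q.2.2)).card = P.card :=
    Finset.card_image_of_injective _ fun q r h => by
      simp only [Prod.mk.injEq] at h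
      ext <;> simp [h]
  have h₂ : (P.image fun q => (q.2.1, q.1.1, q.2.2, q.1.2)).card = P.card :=
    Finset.card_image_of_injective _ fun q r h => by
      simp only [Prod.mk.injEq] at h
      ext <;> simp [h]
  have hdisj : Disjoint (P.image fun q => (q.1.1, q.2.1, q.1.2, q.2.2))
      (P.image fun q => (q.2.1, q.1.1, q.2.2, q.1.2)) := by
    rw [Finset.disjoint_left]
    intro t ht ht'
    obtain ⟨q, hq, rfl⟩ := Finset.mem_image.1 ht
    obtain ⟨r, hr, h⟩ := Finset.mem_image.1 ht'
    simp only [hP, Finset.mem_product, Finset.mem_offDiag, Finset.mem_compl, Prod.mk.injEq]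
      at hq hr h
    exact hr.2.1 (h.1 ▸ hq.1.1)
  rw [two_mul, ← hoff]
  nth_rw 1 [← h₁]
  rw [← h₂, ← Finset.card_union_of_disjoint hdisj]
  refine Finset.card_le_card fun t ht => ?_
  rw [Finset.mem_filter]
  refine ⟨Finset.mem_univ _, ?_⟩
  rcases Finset.mem_union.1 ht with ht | ht <;> obtain ⟨q, hq, rfl⟩ := Finset.mem_image.1 ht <;>
    simp only [hP, hA, Finset.mem_product, Finset.mem_offDiag, Finset.mem_compl,
      Finset.mem_filter, Finset.mem_univ, true_and] at hq <;>
    simp [IsFourCycle, bipartiteAt, hq]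

end SimpleGraph

open SimpleGraph

theorem theorem2p2 (k : ℕ) (hk : 2 ≤ k) :
    (fun n : ℕ => (generalizedTuranNumber n (SimpleGraph.cycleGraph 4)
        (SimpleGraph.cycleGraph (2 * k)) : ℝ)) ~[atTop]
      fun n : ℕ => ((k : ℝ) - 1) * ((k : ℝ) - 2) / 4 * (n : ℝ) ^ 2 := by
  classical
  -- For `k = 2` the right-hand side vanishes, and asymptotic equivalence means eventual equality.
  rcases hk.eq_or_lt with rfl | hk3
  · have h : ∀ n, generalizedTuranNumber n (cycleGraph 4) (cycleGraph (2 * 2)) = 0 := fun n => by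
      rw [generalizedTuranNumber, ← Nat.bot_eq_zero, Finset.sup_eq_bot_iff]
      intro G hG
      exact copyCount_eq_zero.2 (Finset.mem_filter.1 hG).2
    simp only [h]
    norm_num
    rfl
  have hk3' : (3 : ℝ) ≤ k := by exact_mod_cast hk3
  have hc : 0 < ((k : ℝ) - 1) * ((k : ℝ) - 2) / 4 := by
    have h₁ : (0 : ℝ) < k - 1 := by linarith
    have h₂ : (0 : ℝ) < k - 2 := by linarith
    positivity
  set c := ((k : ℝ) - 1) * ((k : ℝ) - 2) / 4 with hcdef
  set Q : ℝ := ((4 * (2 * k + k * 2 ^ (2 * k)) ^ 2 : ℕ) : ℝ) with hQ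
  have hQpos : 0 < Q := by
    rw [hQ]
    exact_mod_cast (by positivity)
  refine isLittleO_iff.2 fun δ hδ => ?_
  filter_upwards [eventually_sum_degree_le k (ε := 8 * δ * c / Q) (by positivity),
    tendsto_natCast_atTop_atTop.eventually_ge_atTop (2 * k / δ), eventually_ge_atTop k]
    with n hdeg hn hkn
  rw [div_le_iff₀ hδ] at hn
  obtain ⟨⟨G, hG, hcount⟩, hmax⟩ := isGreatest_generalizedTuranNumber n (cycleGraph 4)
    (cycleGraph (2 * k)) (fun h => by
      have : (cycleGraph (2 * k)).Adj ⟨0, by omega⟩ ⟨1, by omega⟩ :=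
        pathGraph_le_cycleGraph (by simp [pathGraph_adj])
      simp [h] at this)
  set u := generalizedTuranNumber n (cycleGraph 4) (cycleGraph (2 * k)) with hu
  have hupper : (u : ℝ) ≤ c * n ^ 2 + δ * (c * n ^ 2) := by
    have h₁ := copyCount_cycleGraph_four_le G k hk hG
    rw [hcount, Fintype.card_fin] at h₁
    have h₂ : (8 : ℝ) * u ≤ 2 * (n ^ 2 * ((k - 1) * (k - 2))) + Q * (∑ v, G.degree v : ℕ) := by
      rw [hQ]
      have : ((8 * u : ℕ) : ℝ) ≤ _ := Nat.cast_le.2 h₁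
      rw [Nat.cast_add, Nat.cast_mul _ (∑ v, G.degree v)] at this
      simpa [Nat.cast_sub (show 1 ≤ k by omega), Nat.cast_sub hk] using this
    have h₃ : Q * (∑ v, G.degree v : ℕ) ≤ 8 * (δ * (c * n ^ 2)) := by
      refine (mul_le_mul_of_nonneg_left (hdeg G hG) hQpos.le).trans_eq ?_
      field_simp
    have h₄ : (2 : ℝ) * (n ^ 2 * ((k - 1) * (k - 2))) = 8 * (c * n ^ 2) := by
      rw [hcdef]; ring
    linarith
  have hlower : c * n ^ 2 - δ * (c * n ^ 2) ≤ (u : ℝ) := by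
    have h₁ := le_copyCount_bipartiteAt (s := k - 1) (n := n) (by omega)
    have h₂ : (bipartiteAt (k - 1) n).copyCount (cycleGraph 4) ≤ u :=
      hmax ⟨_, cycleGraph_free_bipartiteAt (by omega) n, rfl⟩
    have h₃ : (2 : ℝ) * (((k - 1) * (k - 2)) * ((n - k + 1) * (n - k))) ≤ 8 * u := by
      obtain ⟨j, rfl⟩ := Nat.exists_eq_add_of_le hk
      obtain ⟨m, rfl⟩ := Nat.exists_eq_add_of_le hkn
      have h := h₁.trans (Nat.mul_le_mul_left 8 h₂)
      rw [show 2 + j - 1 = j + 1 by omega, show 2 + j + m - (j + 1) = m + 1 by omega,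
        Nat.add_sub_cancel, Nat.add_sub_cancel] at h
      have h' : ((2 * ((j + 1) * j * ((m + 1) * m)) : ℕ) : ℝ) ≤ (8 * u : ℕ) := Nat.cast_le.2 h
      push_cast at h' ⊢
      linarith
    have h₄ : (n : ℝ) ^ 2 - δ * n ^ 2 ≤ (n - k + 1) * (n - k) := by
      have := mul_le_mul_of_nonneg_right hn (Nat.cast_nonneg (α := ℝ) n)
      nlinarith
    have h₅ := mul_le_mul_of_nonneg_left h₄ hc.le
    have h₆ : (2 : ℝ) * (((k - 1) * (k - 2)) * ((n - k + 1) * (n - k))) =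
        8 * (c * ((n - k + 1) * (n - k))) := by
      rw [hcdef]; ring
    linarith
  have hcn : 0 ≤ c * (n : ℝ) ^ 2 := by positivity
  rw [Pi.sub_apply, Real.norm_eq_abs, Real.norm_of_nonneg hcn, abs_le]
  constructor <;> linarith
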